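/- Let $K\in\mathbb N$, $\sigma^2>0$ and $\delta\in(0,1)$. An environment $v$ assigns to each arm $i\in[K]=\{1,\dots,K\}$ the reward distribution $v(i)=N(\mu_{v,i},\sigma^2)$; its change points are the $j\in[K-1]$ with $\mu_{v,j}\neq\mu_{v,j+1}$, and $V_{K,1}$ denotes the set of environments with exactly one change point, written $x^*_v$. In round $t=1,2,\dots$ a policy $\pi$ plays an action $a_t\in[K]$ chosen from the past actions and rewards (and possibly internal randomness, whose law does not depend on the environment) and observes $y_t=\mu_{v,a_t}+\epsilon_t$, where the $\epsilon_t$ are i.i.d. $N(0,\sigma^2)$, independent of the internal randomness. The policy stops after $\tau$ rounds, where $\tau\in\{0,1,2,\dots\}\cup\{\infty\}$ is a stopping time of the filtration generated by these observations, and returns an estimate $\hat x_\tau\in[K-1]$ that is determined by the observations up to time $\tau$. Let $\mathbb P_{\pi,v}$ be the law of the interaction of $\pi$ with $v$, and $\mathbb E_{\pi,v}$ its expectation. The policy $\pi$ is called Exact-$(1,\delta)$ if for every $v\in V_{K,1}$ $$\mathbb P_{\pi,v}(\hat x_\tau=x^*_v)>1-\delta\qquad\text{and}\qquad \mathbb P_{\pi,v}(\tau<\infty)=1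 .$$ Theorem. For every Exact-$(1,\delta)$ policy $\pi$ with stopping time $\tau$ and every $v\in V_{K,1}$, $$\mathbb E_{\pi,v}[\tau]\;\ge\; c^*(v)\,\log\Big(\frac1{4\delta}\Big),\qquad c^*(v)^{-1}=\sup_{\alpha\in\mathcal P_K}\ \inf_{v'\in V^{\mathrm{alt}}_{K,1}(x^*_v)}\ \sum_{i=1}^K\alpha_i\,D\big(v(i),v'(i)\big),$$ where $\mathcal P_K$ is the standard simplex $\{\alpha\in[0,1]^K:\sum_i\alpha_i=1\}$, $V^{\mathrm{alt}}_{K,1}(x^*_v)$ is the set of environments in $V_{K,1}$ whose change point is not $x^*_v$, and $D$ is the Kullback–Leibler divergence. The supremum and infimum are taken in $[0,\infty]$, with $\inf\emptyset=\infty$ and $1/\infty=0$ (relevant only for $K=2$, where there is no alternative and $c^*(v)=0$). -/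

import Mathlib

open MeasureTheory ProbabilityTheory
open scoped ENNReal NNReal

namespace PiecewiseBandit

/-- The change points of a vector `μ` of mean rewards of `K` arms. Arms and change points are
numbered from `0`: `j` is a change point when the mean reward changes between arms `j` and
`j + 1`. -/
noncomputable def changePoints {K : ℕ} (μ : Fin K → ℝ) : Finset (Fin (K - 1)) :=
  {j | μ ⟨j, by omega⟩ ≠ μ ⟨j + 1, by omega⟩}

/-- `V_{K,N}`: the environments with `K` arms and exactly `N` change points, any two of which are
separated by at least one action. The noise variance being known and common to all arms, an
environment is given by its mean rewards. -/
def Environments (K N : ℕ) : Set (Fin K → ℝ) :=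
  {μ | (changePoints μ).card = N ∧
    ∀ x ∈ changePoints μ, ∀ y ∈ changePoints μ, x < y → (x : ℕ) + 1 < y}

/-- The environments with exactly one change point, which is not the change point of `μ`. -/
def Alternatives {K : ℕ} (μ : Fin K → ℝ) : Set (Fin K → ℝ) :=
  {μ' | μ' ∈ Environments K 1 ∧ changePoints μ' ≠ changePoints μ}

/-- The actions and rewards of the first `n` rounds. -/
abbrev History (K n : ℕ) : Type := Fin n → Fin K × ℝ

/-- All that a policy can observe: its internal randomness and the infinite sequence of actions
and rewards. -/
abbrev Path (K : ℕ) (U : Type*) : Type _ := U × (ℕ → Fin K × ℝ)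

/-- The internal randomness together with the actions and rewards of the first `n` rounds. -/
def observed {K : ℕ} {U : Type*} (n : ℕ) (p : Path K U) : U × History K n :=
  (p.1, fun i => p.2 i)

theorem measurable_observed {K : ℕ} {U : Type*} [MeasurableSpace U] (n : ℕ) :
    Measurable (observed (K := K) (U := U) n) := by
  unfold observed
  fun_prop

/-- The information available after `n` rounds. -/
def obsFiltration (K : ℕ) (U : Type*) [MeasurableSpace U] :
    Filtration ℕ (inferInstance : MeasurableSpace (Path K U)) where
  seq n := MeasurableSpace.comap (observed n) inferInstance
  mono' m n hmn := by
    have h : Measurable (fun q : U × History K n =>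
        ((q.1, fun i : Fin m => q.2 (Fin.castLE hmn i)) : U × History K m)) := by
      fun_prop
    rintro _ ⟨s, hs, rfl⟩
    exact ⟨_, h hs, rfl⟩
  le' n := (measurable_observed n).comap_le

/-- A policy on `K` arms. It may randomize, through a seed drawn from `U` before the first round;
a deterministic policy is the case where `U` is a point. -/
structure Policy (K : ℕ) (U : Type*) [MeasurableSpace U] where
  /-- law of the internal randomness -/
  seed : Measure U
  seed_prob : IsProbabilityMeasure seed
  /-- sampling rule: the action that follows the first `n` rounds -/
  act : (n : ℕ) → U × History K n → Fin K
  measurable_act : ∀ n, Measurable (act n)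
  /-- stopping rule: the number of rounds played, possibly infinite -/
  τ : Path K U → ℕ∞
  isStoppingTime : IsStoppingTime (obsFiltration K U) τ
  /-- recommendation rule: the estimated change point, a function of what is observed up to
  the stopping time -/
  estimate : Path K U → Fin (K - 1)
  measurable_estimate : Measurable[isStoppingTime.measurableSpace] estimate

namespace Policy

variable {K : ℕ} {U : Type*} [MeasurableSpace U]

/-- The first `n` rounds of the interaction of the policy with the environment `μ`, as a function
of the seed and of the noise: in each round the reward is `y = μ a + ε`. -/
def history (π : Policy K U) (μ : Fin K → ℝ) (u : U) (ε : ℕ → ℝ) : (n : ℕ) → History K n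
  | 0 => Fin.elim0
  | n + 1 =>
    let h := history π μ u ε n
    let a := π.act n (u, h)
    Fin.snoc (α := fun _ => Fin K × ℝ) h (a, μ a + ε n)

/-- The infinite interaction of the policy with the environment `μ`. -/
def path (π : Policy K U) (μ : Fin K → ℝ) (ω : U × (ℕ → ℝ)) : Path K U :=
  (ω.1, fun n =>
    let a := π.act n (ω.1, π.history μ ω.1 ω.2 n)
    (a, μ a + ω.2 n))

/-- `ℙ_{π,v}`: the law of the interaction of the policy with the environment `μ`, the noise being
i.i.d. centred Gaussian of variance `σ2` and independent of the seed. -/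
noncomputable def law (π : Policy K U) (σ2 : ℝ≥0) (μ : Fin K → ℝ) : Measure (Path K U) :=
  (π.seed.prod (Measure.infinitePi fun _ : ℕ => gaussianReal 0 σ2)).map (π.path μ)

theorem measurable_history (π : Policy K U) (μ : Fin K → ℝ) (n : ℕ) :
    Measurable fun ω : U × (ℕ → ℝ) => π.history μ ω.1 ω.2 n := by
  induction n with
  | zero => exact measurable_const
  | succ n ih =>
    have ha : Measurable fun ω : U × (ℕ → ℝ) => π.act n (ω.1, π.history μ ω.1 ω.2 n) :=
      (π.measurable_act n).comp (measurable_fst.prodMk ih)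
    have hm : Measurable fun ω : U × (ℕ → ℝ) => μ (π.act n (ω.1, π.history μ ω.1 ω.2 n)) :=
      (measurable_of_finite μ).comp ha
    refine measurable_pi_lambda _ fun i => ?_
    refine Fin.lastCases ?_ (fun i => ?_) i
    · simp only [history, Fin.snoc_last]
      fun_prop
    · simp only [history, Fin.snoc_castSucc]
      exact (measurable_pi_apply i).comp ih

theorem measurable_path (π : Policy K U) (μ : Fin K → ℝ) : Measurable (π.path μ) := by
  refine measurable_fst.prodMk (measurable_pi_lambda _ fun n => ?_)
  have ha : Measurable fun ω : U × (ℕ → ℝ) => π.act n (ω.1, π.history μ ω.1 ω.2 n) :=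
    (π.measurable_act n).comp (measurable_fst.prodMk (π.measurable_history μ n))
  have hm : Measurable fun ω : U × (ℕ → ℝ) => μ (π.act n (ω.1, π.history μ ω.1 ω.2 n)) :=
    (measurable_of_finite μ).comp ha
  simp only
  fun_prop

theorem isProbabilityMeasure_law (π : Policy K U) (σ2 : ℝ≥0) (μ : Fin K → ℝ) :
    IsProbabilityMeasure (π.law σ2 μ) := by
  have := π.seed_prob
  exact Measure.isProbabilityMeasure_map (π.measurable_path μ).aemeasurable

/-- The path of an interaction indeed starts with its history. -/
theorem observed_path (π : Policy K U) (μ : Fin K → ℝ) (ω : U × (ℕ → ℝ)) (n : ℕ) :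
    observed n (π.path μ ω) = (ω.1, π.history μ ω.1 ω.2 n) := by
  refine Prod.ext rfl ?_
  induction n with
  | zero => exact Subsingleton.elim _ _
  | succ n ih =>
    funext i
    refine Fin.lastCases ?_ (fun i => ?_) i
    · simp [observed, path, history]
    · simpa [observed, path, history] using congrFun ih i

/-- `𝔼_{π,v}[τ]`, with values in `[0, ∞]`. -/
noncomputable def expectedStop (π : Policy K U) (σ2 : ℝ≥0) (μ : Fin K → ℝ) : ℝ≥0∞ :=
  ∫⁻ p, (π.τ p : ℝ≥0∞) ∂(π.law σ2 μ)

/-- Exact-`(1,δ)` policies. For `μ` with exactly one change point, `changePoints μ = {x}` says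
that `x` is the change point of `μ`. -/
def IsExactOne (π : Policy K U) (σ2 : ℝ≥0) (δ : ℝ) : Prop :=
  ∀ μ ∈ Environments K 1,
    1 - δ < (π.law σ2 μ).real {p | changePoints μ = {π.estimate p}} ∧
    π.law σ2 μ {p | π.τ p < ⊤} = 1

end Policy

/-- `c*(v)`, where `c*(v)⁻¹ = sup_α inf_{v'} ∑ᵢ αᵢ D(v(i), v'(i))`, computed in `[0, ∞]`; the
infimum over an empty set of alternatives is `∞`. -/
noncomputable def cStar {K : ℕ} (σ2 : ℝ≥0) (μ : Fin K → ℝ) : ℝ≥0∞ :=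
  (⨆ α ∈ stdSimplex ℝ (Fin K), ⨅ μ' ∈ Alternatives μ,
    ∑ i, ENNReal.ofReal (α i) *
      InformationTheory.klDiv (gaussianReal (μ i) σ2) (gaussianReal (μ' i) σ2))⁻¹

end PiecewiseBandit

/-! Fix an alternative `μ'` and let `L` be the log-likelihood ratio of `μ` to `μ'` at the stopping
time. Two facts about `L` meet. By Wald's identity (`integrable_integral_armLLR`) its mean under `μ`
is the sum over arms of the expected plays times `(μ i - μ' i) ^ 2 / (2 * v)`. By the stopped change
of measure (`lintegral_exp_neg_armLLR_le`), the `μ`-mean of `exp (-L)` on an event `B` known at the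
stopping time is at most the `μ'`-probability of `B`.

Let `B` be correctness of the estimate for `μ`, or its complement: it has probability at least `1 -
δ` under `μ` and at most `δ` under `μ'`. Integrating the elementary bound `L ≥ 1 - s * exp (-L) +
log s`, with one constant `s` on each of the two events, forces the mean of `L` to be at least `log
(1 / (4 * δ))` (`log_le_sum_expectedPlays`). This replaces data processing and binary relative
entropy.

The normalized expected plays form a point `α` of the simplex that does not depend on `μ'`. Dividing
by the expected stopping time bounds the infimum at this `α`, hence the supremum, from below. -/

namespace PiecewiseBandit

/-! ### Gaussian log-likelihood ratios -/

/-- The log-likelihood ratio of `N(a, v)` with respect to `N(b, v)`. -/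
noncomputable def gaussLLR (a b : ℝ) (v : ℝ≥0) (y : ℝ) : ℝ :=
  ((y - b) ^ 2 - (y - a) ^ 2) / (2 * v)

theorem measurable_gaussLLR (a b : ℝ) (v : ℝ≥0) : Measurable (gaussLLR a b v) := by
  unfold gaussLLR
  fun_prop

/-- With equal variances the quadratic terms in `y` cancel, so integrability and mean reduce to the
first moment. At `v = 0` both sides are `0`, by division by zero. -/
theorem gaussLLR_eq_linear (a b : ℝ) (v : ℝ≥0) (y : ℝ) :
    gaussLLR a b v y = (a - b) / v * y + (b ^ 2 - a ^ 2) / (2 * v) := by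
  unfold gaussLLR
  by_cases hv : (v : ℝ) = 0
  · simp [hv]
  · field_simp
    ring

theorem integrable_gaussLLR (a b c : ℝ) (v : ℝ≥0) :
    Integrable (gaussLLR a b v) (gaussianReal c v) := by
  have h : Integrable (fun y : ℝ => y) (gaussianReal c v) :=
    (memLp_id_gaussianReal 1).integrable le_rfl
  simp_rw [funext (gaussLLR_eq_linear a b v)]
  exact (h.const_mul _).add (integrable_const _)

theorem integral_gaussLLR (a b : ℝ) (v : ℝ≥0) :
    ∫ y, gaussLLR a b v y ∂(gaussianReal a v) = (a - b) ^ 2 / (2 * v) := by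
  have h : Integrable (fun y : ℝ => y) (gaussianReal a v) :=
    (memLp_id_gaussianReal 1).integrable le_rfl
  simp_rw [gaussLLR_eq_linear]
  rw [integral_add (h.const_mul _) (integrable_const _), integral_const_mul,
    integral_id_gaussianReal]
  simp only [integral_const, probReal_univ, one_smul]
  by_cases hv : (v : ℝ) = 0
  · simp [hv]
  · field_simp
    ring

theorem gaussianReal_eq_withDensity (a b : ℝ) {v : ℝ≥0} (hv : v ≠ 0) :
    gaussianReal b v =
      (gaussianReal a v).withDensity fun y => ENNReal.ofReal (Real.exp (-gaussLLR a b v y)) := by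
  have hm : Measurable fun y => ENNReal.ofReal (Real.exp (-gaussLLR a b v y)) :=
    ((measurable_gaussLLR a b v).neg.exp).ennreal_ofReal
  rw [gaussianReal_of_var_ne_zero _ hv, gaussianReal_of_var_ne_zero _ hv,
    ← withDensity_mul _ (measurable_gaussianPDF _ _) hm]
  congr 1
  ext y
  simp only [Pi.mul_apply, gaussianPDF]
  rw [← ENNReal.ofReal_mul (gaussianPDFReal_nonneg _ _ _)]
  congr 1
  simp only [gaussianPDFReal]
  conv_rhs => rw [mul_assoc, ← Real.exp_add]
  congr 2
  unfold gaussLLR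
  ring

/-- Only this direction matters, since the divergence enters an upper bound for the information per
round. Absolute continuity and integrability need no check: where they fail, `klDiv` is `∞`. -/
theorem le_klDiv_gaussianReal (a b : ℝ) {v : ℝ≥0} (hv : v ≠ 0) :
    ENNReal.ofReal ((a - b) ^ 2 / (2 * v)) ≤
      InformationTheory.klDiv (gaussianReal a v) (gaussianReal b v) := by
  rw [InformationTheory.klDiv_def]
  split_ifs with h
  · refine ENNReal.ofReal_le_ofReal ?_
    have hllr : llr (gaussianReal a v) (gaussianReal b v) =ᵐ[gaussianReal a v]
        gaussLLR a b v := by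
      have hm : Measurable fun y => ENNReal.ofReal (Real.exp (-gaussLLR b a v y)) :=
        ((measurable_gaussLLR b a v).neg.exp).ennreal_ofReal
      have h1 := Measure.rnDeriv_withDensity (gaussianReal b v) hm
      rw [← gaussianReal_eq_withDensity b a hv] at h1
      filter_upwards [h.1.ae_le h1] with y hy
      rw [llr, hy, ENNReal.toReal_ofReal (Real.exp_pos _).le, Real.log_exp]
      unfold gaussLLR
      ring
    rw [integral_congr_ae hllr, integral_gaussLLR]
    simp
  · exact le_top

/-- Changing the mean of a Gaussian reward from `b` to `a`. -/
theorem lintegral_gaussianReal_shift (a b : ℝ) {v : ℝ≥0} (hv : v ≠ 0) {f : ℝ → ℝ≥0∞}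
    (hf : Measurable f) :
    ∫⁻ e, f (b + e) ∂(gaussianReal 0 v) =
      ∫⁻ e, f (a + e) * ENNReal.ofReal (Real.exp (-gaussLLR a b v (a + e)))
        ∂(gaussianReal 0 v) := by
  have hm : Measurable fun y => ENNReal.ofReal (Real.exp (-gaussLLR a b v y)) :=
    ((measurable_gaussLLR a b v).neg.exp).ennreal_ofReal
  have key : ∀ (c : ℝ) (g : ℝ → ℝ≥0∞), Measurable g →
      ∫⁻ e, g (c + e) ∂(gaussianReal 0 v) = ∫⁻ y, g y ∂(gaussianReal c v) := by
    intro c g hg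
    have h := gaussianReal_map_const_add (μ := 0) (v := v) c
    rw [zero_add] at h
    rw [← h, lintegral_map hg (by fun_prop)]
  rw [key b f hf, key a (fun y => f y * ENNReal.ofReal (Real.exp (-gaussLLR a b v y)))
    (hf.mul hm), gaussianReal_eq_withDensity a b hv, lintegral_withDensity_eq_lintegral_mul _ hm hf]
  simp only [Pi.mul_apply, mul_comm]

/-! ### Independence of the noise from the past, and change of measure at a fixed round -/

/-- The log-likelihood ratio, between two environments, of the rewards of the first rounds. -/
noncomputable def logLR {K : ℕ} (μ μ' : Fin K → ℝ) (v : ℝ≥0) (n : ℕ) (h : History K n) : ℝ :=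
  ∑ i, gaussLLR (μ (h i).1) (μ' (h i).1) v (h i).2

theorem measurable_logLR {K : ℕ} (μ μ' : Fin K → ℝ) (v : ℝ≥0) (n : ℕ) :
    Measurable (logLR μ μ' v n) := by
  unfold logLR gaussLLR
  refine Finset.measurable_sum _ fun i _ => ?_
  have h1 : Measurable fun h : History K n => μ (h i).1 :=
    (measurable_of_finite μ).comp (by fun_prop)
  have h2 : Measurable fun h : History K n => μ' (h i).1 :=
    (measurable_of_finite μ').comp (by fun_prop)
  fun_prop

theorem logLR_snoc {K : ℕ} (μ μ' : Fin K → ℝ) (v : ℝ≥0) (n : ℕ) (h : History K n)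
    (a : Fin K) (y : ℝ) :
    logLR μ μ' v (n + 1) (Fin.snoc (α := fun _ => Fin K × ℝ) h (a, y)) =
      logLR μ μ' v n h + gaussLLR (μ a) (μ' a) v y := by
  simp [logLR, Fin.sum_univ_castSucc]

theorem measurable_snoc_history {K n : ℕ} {X : Type*} [MeasurableSpace X] {f : X → History K n}
    {g : X → Fin K × ℝ} (hf : Measurable f) (hg : Measurable g) :
    Measurable fun x => (Fin.snoc (α := fun _ => Fin K × ℝ) (f x) (g x) : History K (n + 1)) := by
  refine measurable_pi_lambda _ fun i => ?_
  refine Fin.lastCases ?_ (fun i => ?_) i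
  · simpa only [Fin.snoc_last] using hg
  · simp only [Fin.snoc_castSucc]
    exact (measurable_pi_apply i).comp hf

namespace Policy

variable {K : ℕ} {U : Type*} [MeasurableSpace U]

theorem history_congr (π : Policy K U) (μ : Fin K → ℝ) (u : U) {ε ε' : ℕ → ℝ} {n : ℕ}
    (h : ∀ i < n, ε i = ε' i) : π.history μ u ε n = π.history μ u ε' n := by
  induction n with
  | zero => rfl
  | succ n ih => simp only [history, ih fun i hi => h i (by omega), h n (by omega)]

/-- For a given seed, the noise of a round is independent of the preceding rounds. -/
theorem indepFun_history_noise_of_seed (π : Policy K U) (μ : Fin K → ℝ) (v : ℝ≥0) (u : U)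
    (n : ℕ) :
    IndepFun (fun ε : ℕ → ℝ => π.history μ u ε n) (fun ε => ε n)
      (Measure.infinitePi fun _ : ℕ => gaussianReal 0 v) := by
  have hind : iIndepFun (fun (i : ℕ) (ε : ℕ → ℝ) => ε i)
      (Measure.infinitePi fun _ : ℕ => gaussianReal 0 v) :=
    iIndepFun_infinitePi (P := fun _ : ℕ => gaussianReal 0 v) (X := fun _ x => x)
      fun _ => measurable_id
  have h := hind.indepFun_finset (Finset.range n) {n} (by simp) fun i => measurable_pi_apply i
  -- Extending the first `n` noises by zero exhibits the history as a function of finitely many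
  -- coordinates, disjoint from coordinate `n`; by `history_congr` the added values are irrelevant.
  let ext : ((Finset.range n) → ℝ) → ℕ → ℝ := fun x i =>
    if hi : i ∈ Finset.range n then x ⟨i, hi⟩ else 0
  have hext : Measurable ext := by
    refine measurable_pi_lambda _ fun i => ?_
    by_cases hi : i ∈ Finset.range n
    · simp only [ext, hi, dite_true]
      fun_prop
    · simp only [ext, hi, dite_false]
      fun_prop
  have hφ : Measurable fun x => π.history μ u (ext x) n :=
    ((π.measurable_history μ n).comp measurable_prodMk_left).comp hext
  have h' := h.comp hφ (measurable_pi_apply (⟨n, by simp⟩ : ({n} : Finset ℕ)))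
  have heq : (fun ε : ℕ → ℝ => π.history μ u ε n) =
      (fun x => π.history μ u (ext x) n) ∘ fun ε i => ε i := by
    funext ε
    refine history_congr π μ u fun i hi => ?_
    simp [ext, hi]
  rw [heq]
  exact h'

/-- The law of the seed and of the noise, the probability space of the interaction. -/
noncomputable def noiseLaw (π : Policy K U) (v : ℝ≥0) : Measure (U × (ℕ → ℝ)) :=
  π.seed.prod (Measure.infinitePi fun _ : ℕ => gaussianReal 0 v)

instance (π : Policy K U) : IsProbabilityMeasure π.seed := π.seed_prob

instance (π : Policy K U) (v : ℝ≥0) : IsProbabilityMeasure (π.noiseLaw v) := by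
  unfold noiseLaw
  infer_instance

/-- For each fixed seed the history and the noise of round `n` have a product law; Fubini over the
seed then integrates that noise out separately. -/
theorem lintegral_noise (π : Policy K U) (μ : Fin K → ℝ) (v : ℝ≥0) (n : ℕ)
    {F : (U × History K n) × ℝ → ℝ≥0∞} (hF : Measurable F) :
    ∫⁻ ω, F ((ω.1, π.history μ ω.1 ω.2 n), ω.2 n) ∂(π.noiseLaw v) =
      ∫⁻ ω, ∫⁻ e, F ((ω.1, π.history μ ω.1 ω.2 n), e) ∂(gaussianReal 0 v) ∂(π.noiseLaw v) := by
  have hH := π.measurable_history μ n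
  have hN : Measurable fun ω : U × (ℕ → ℝ) => ω.2 n := by fun_prop
  have hF' : Measurable fun q : U × History K n => ∫⁻ e, F (q, e) ∂(gaussianReal 0 v) :=
    hF.lintegral_prod_right'
  have hq : Measurable fun ω : U × (ℕ → ℝ) => (ω.1, π.history μ ω.1 ω.2 n) :=
    measurable_fst.prodMk hH
  unfold noiseLaw
  rw [lintegral_prod (fun ω : U × (ℕ → ℝ) => F ((ω.1, π.history μ ω.1 ω.2 n), ω.2 n))
      (hF.comp (hq.prodMk hN)).aemeasurable,
    lintegral_prod (fun ω : U × (ℕ → ℝ) => ∫⁻ e, F ((ω.1, π.history μ ω.1 ω.2 n), e)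
      ∂(gaussianReal 0 v)) (hF'.comp hq).aemeasurable]
  refine lintegral_congr fun u => ?_
  have hHu : Measurable fun ε : ℕ → ℝ => π.history μ u ε n := hH.comp measurable_prodMk_left
  have hmap := (π.indepFun_history_noise_of_seed μ v u n).map_prod_eq_prod_map_map
    hHu.aemeasurable (measurable_pi_apply n).aemeasurable
  have hn : (Measure.infinitePi fun _ : ℕ => gaussianReal 0 v).map (fun ε => ε n) =
      gaussianReal 0 v := Measure.infinitePi_map_eval _ n
  have hFu : Measurable fun z : History K n × ℝ => F ((u, z.1), z.2) := by fun_prop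
  have h1 := lintegral_map (μ := Measure.infinitePi fun _ : ℕ => gaussianReal 0 v) hFu
    (hHu.prodMk (measurable_pi_apply n))
  have : IsProbabilityMeasure ((Measure.infinitePi fun _ : ℕ => gaussianReal 0 v).map
      fun ε => π.history μ u ε n) := Measure.isProbabilityMeasure_map hHu.aemeasurable
  rw [hmap, hn, lintegral_prod _ hFu.aemeasurable,
    lintegral_map (f := fun h => ∫⁻ e, F ((u, h), e) ∂(gaussianReal 0 v))
      hFu.lintegral_prod_right' hHu] at h1
  exact h1.symm

theorem indepFun_history_noise (π : Policy K U) (μ : Fin K → ℝ) (v : ℝ≥0) (n : ℕ) :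
    IndepFun (fun ω : U × (ℕ → ℝ) => (ω.1, π.history μ ω.1 ω.2 n)) (fun ω => ω.2 n)
      (π.noiseLaw v) := by
  have hq : Measurable fun ω : U × (ℕ → ℝ) => (ω.1, π.history μ ω.1 ω.2 n) :=
    measurable_fst.prodMk (π.measurable_history μ n)
  have hN : Measurable fun ω : U × (ℕ → ℝ) => ω.2 n := by fun_prop
  rw [indepFun_iff_measure_inter_preimage_eq_mul]
  intro s t hs ht
  have key : ∀ s' : Set (U × History K n), MeasurableSet s' →
      π.noiseLaw v ((fun ω : U × (ℕ → ℝ) => (ω.1, π.history μ ω.1 ω.2 n)) ⁻¹' s' ∩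
        (fun ω => ω.2 n) ⁻¹' t) =
      π.noiseLaw v ((fun ω : U × (ℕ → ℝ) => (ω.1, π.history μ ω.1 ω.2 n)) ⁻¹' s') *
        gaussianReal 0 v t := by
    intro s' hs'
    have h := π.lintegral_noise μ v n
      (F := (s' ×ˢ t).indicator 1) (measurable_one.indicator (hs'.prod ht))
    have h1 : ∀ ω : U × (ℕ → ℝ),
        (s' ×ˢ t).indicator (1 : (U × History K n) × ℝ → ℝ≥0∞)
          ((ω.1, π.history μ ω.1 ω.2 n), ω.2 n) =
        ((fun ω : U × (ℕ → ℝ) => (ω.1, π.history μ ω.1 ω.2 n)) ⁻¹' s' ∩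
        (fun ω => ω.2 n) ⁻¹' t).indicator 1 ω := fun ω => rfl
    have h2 : ∀ ω : U × (ℕ → ℝ), ∫⁻ e, (s' ×ˢ t).indicator (1 : (U × History K n) × ℝ → ℝ≥0∞)
        ((ω.1, π.history μ ω.1 ω.2 n), e) ∂(gaussianReal 0 v) =
        ((fun ω : U × (ℕ → ℝ) => (ω.1, π.history μ ω.1 ω.2 n)) ⁻¹' s').indicator 1 ω *
          gaussianReal 0 v t := by
      intro ω
      rw [← lintegral_indicator_one ht, ← lintegral_const_mul _ (measurable_one.indicator ht)]
      refine lintegral_congr fun e => ?_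
      simp only [Set.indicator, Set.mem_prod, Set.mem_preimage, Pi.one_apply]
      split_ifs <;> simp_all
    simp_rw [h1, h2] at h
    rwa [lintegral_indicator_one ((hq hs').inter (hN ht)),
      lintegral_mul_const _ (measurable_one.indicator (hq hs')),
      lintegral_indicator_one (hq hs')] at h
  -- The whole space as `s'` identifies the Gaussian mass of `t` with the probability that the noise
  -- lies in `t`.
  have hT := key Set.univ MeasurableSet.univ
  simp only [Set.preimage_univ, Set.univ_inter, measure_univ, one_mul] at hT
  rw [key s hs, hT]

/-- Change of measure for the first `n` rounds. -/
theorem lintegral_history_change (π : Policy K U) (μ μ' : Fin K → ℝ) {v : ℝ≥0} (hv : v ≠ 0)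
    (n : ℕ) {f : U × History K n → ℝ≥0∞} (hf : Measurable f) :
    ∫⁻ ω, f (ω.1, π.history μ' ω.1 ω.2 n) ∂(π.noiseLaw v) =
      ∫⁻ ω, f (ω.1, π.history μ ω.1 ω.2 n) *
        ENNReal.ofReal (Real.exp (-logLR μ μ' v n (π.history μ ω.1 ω.2 n))) ∂(π.noiseLaw v) := by
  induction n with
  | zero => simp [logLR, history]
  | succ n ih =>
    have hnext : ∀ ν : Fin K → ℝ, Measurable fun z : (U × History K n) × ℝ =>
        ((z.1.1, Fin.snoc (α := fun _ => Fin K × ℝ) z.1.2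
          (π.act n z.1, ν (π.act n z.1) + z.2)) : U × History K (n + 1)) := by
      intro ν
      have ha : Measurable fun z : (U × History K n) × ℝ => π.act n z.1 :=
        (π.measurable_act n).comp measurable_fst
      have hm : Measurable fun z : (U × History K n) × ℝ => ν (π.act n z.1) :=
        (measurable_of_finite ν).comp ha
      exact (measurable_fst.comp measurable_fst).prodMk
        (measurable_snoc_history (measurable_snd.comp measurable_fst)
          (ha.prodMk (hm.add measurable_snd)))
    have hw : Measurable fun z : U × History K (n + 1) =>
        f z * ENNReal.ofReal (Real.exp (-logLR μ μ' v (n + 1) z.2)) :=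
      hf.mul (((measurable_logLR μ μ' v (n + 1)).comp measurable_snd).neg.exp.ennreal_ofReal)
    -- The last noise is integrated out in both environments. The induction hypothesis changes the
    -- environment of the first `n` rounds, and `lintegral_gaussianReal_shift` that of the last
    -- reward.
    have h1 := π.lintegral_noise μ' v n (hf.comp (hnext μ'))
    have h2 := π.lintegral_noise μ v n (hw.comp (hnext μ))
    refine Eq.trans h1 (Eq.trans ?_ h2.symm)
    rw [ih (f := fun q => ∫⁻ e, (f ∘ fun z : (U × History K n) × ℝ =>
        ((z.1.1, Fin.snoc (α := fun _ => Fin K × ℝ) z.1.2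
          (π.act n z.1, μ' (π.act n z.1) + z.2)) : U × History K (n + 1))) (q, e)
        ∂(gaussianReal 0 v)) (hf.comp (hnext μ')).lintegral_prod_right']
    refine lintegral_congr fun ω => ?_
    set h := π.history μ ω.1 ω.2 n
    set a := π.act n (ω.1, h)
    simp only [Function.comp_apply]
    rw [lintegral_gaussianReal_shift (μ a) (μ' a) hv
      (f := fun y => f (ω.1, Fin.snoc (α := fun _ => Fin K × ℝ) h (a, y)))
      (hf.comp (measurable_const.prodMk
        (measurable_snoc_history measurable_const (by fun_prop)))),
      mul_comm, ← lintegral_const_mul']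
    · refine lintegral_congr fun e => ?_
      rw [logLR_snoc, neg_add, Real.exp_add, ENNReal.ofReal_mul (Real.exp_pos _).le]
      ring
    · exact ENNReal.ofReal_ne_top

end Policy

/-! ### Plays before stopping and Wald's identity -/

/-- By Tonelli the series of norms has a finite integral. It therefore converges almost everywhere,
and the sum is measurable as an almost everywhere limit of partial sums. -/
theorem integrable_tsum_of_summable_integral_norm {α : Type*} [MeasurableSpace α] {m : Measure α}
    {F : ℕ → α → ℝ} (hF : ∀ t, Integrable (F t) m) (hs : Summable fun t => ∫ a, ‖F t a‖ ∂m) :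
    Integrable (fun a => ∑' t, F t a) m := by
  have hfin : ∫⁻ a, ∑' t, ‖F t a‖ₑ ∂m < ∞ := by
    rw [lintegral_tsum fun t => (hF t).aestronglyMeasurable.enorm]
    have h : ∀ t, ∫⁻ a, ‖F t a‖ₑ ∂m = ENNReal.ofReal (∫ a, ‖F t a‖ ∂m) := fun t =>
      (ofReal_integral_norm_eq_lintegral_enorm (hF t)).symm
    simp_rw [h]
    rw [← ENNReal.ofReal_tsum_of_nonneg (fun t => integral_nonneg fun a => norm_nonneg _) hs]
    exact ENNReal.ofReal_lt_top
  refine ⟨?_, lt_of_le_of_lt (lintegral_mono fun a => enorm_tsum_le_tsum_enorm) hfin⟩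
  have hsum : ∀ᵐ a ∂m, Summable fun t => F t a := by
    refine (ae_lt_top' (AEMeasurable.tsum fun t => (hF t).aestronglyMeasurable.enorm)
      hfin.ne).mono fun a ha => ?_
    exact (tsum_enorm_ne_top_iff_summable_norm.1 ha.ne).of_norm
  refine aestronglyMeasurable_of_tendsto_ae Filter.atTop
    (f := fun n a => ∑ t ∈ Finset.range n, F t a) (fun n => ?_) ?_
  · exact Finset.aestronglyMeasurable_fun_sum _ fun t _ => (hF t).aestronglyMeasurable
  · filter_upwards [hsum] with a ha
    exact ha.hasSum.tendsto_sum_nat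

/-- This is the tail-sum formula behind the expected stopping time: rounds are numbered from `0`,
and round `t` is played when `t < τ`. -/
theorem toENNReal_eq_tsum (n : ℕ∞) :
    (n : ℝ≥0∞) = ∑' t : ℕ, {t : ℕ | (t : ℕ∞) < n}.indicator (1 : ℕ → ℝ≥0∞) t := by
  induction n with
  | top =>
    have : {t : ℕ | (t : ℕ∞) < ⊤} = Set.univ := by
      ext t
      simp
    rw [this, Set.indicator_univ]
    simp
  | coe n =>
    rw [tsum_eq_sum (s := Finset.range n)]
    · rw [Finset.sum_congr rfl (g := fun _ => (1 : ℝ≥0∞))]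
      · simp
      · intro t ht
        exact Set.indicator_of_mem (by simpa using ht) _
    · intro t ht
      simpa using ht

namespace Policy

variable {K : ℕ} {U : Type*} [MeasurableSpace U]

/-- The event that round `t` is played and that its action is `i`, in the environment `μ`. -/
def playEvent (π : Policy K U) (μ : Fin K → ℝ) (t : ℕ) (i : Fin K) : Set (U × (ℕ → ℝ)) :=
  {ω | (t : ℕ∞) < π.τ (π.path μ ω) ∧ π.act t (ω.1, π.history μ ω.1 ω.2 t) = i}

/-- The middle clause does not involve `μ`, so the same `T` describes the event in every
environment; the stopped change of measure relies on this. -/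
theorem path_mem_iff_history_mem (π : Policy K U) (μ : Fin K → ℝ) {n : ℕ} {B : Set (Path K U)}
    (hB : MeasurableSet[obsFiltration K U n] B) :
    ∃ T : Set (U × History K n), MeasurableSet T ∧
      (∀ p, p ∈ B ↔ observed n p ∈ T) ∧
      ∀ ω, π.path μ ω ∈ B ↔ (ω.1, π.history μ ω.1 ω.2 n) ∈ T := by
  obtain ⟨T, hT, rfl⟩ := hB
  exact ⟨T, hT, fun p => Iff.rfl, fun ω => by rw [← π.observed_path μ ω n]; rfl⟩

/-- Predictability: the first `t` rounds decide both whether round `t` is played and with which arm,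
so the event is independent of the noise of that round. -/
theorem exists_playEvent_eq_preimage (π : Policy K U) (μ : Fin K → ℝ) (t : ℕ) (i : Fin K) :
    ∃ T : Set (U × History K t), MeasurableSet T ∧
      π.playEvent μ t i = (fun ω => (ω.1, π.history μ ω.1 ω.2 t)) ⁻¹' T := by
  obtain ⟨T, hT, -, h⟩ := π.path_mem_iff_history_mem μ (π.isStoppingTime.measurableSet_gt t)
  refine ⟨T ∩ π.act t ⁻¹' {i}, hT.inter (π.measurable_act t (measurableSet_singleton i)), ?_⟩
  ext ω
  exact and_congr (h ω) Iff.rfl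

theorem measurable_seed_history (π : Policy K U) (μ : Fin K → ℝ) (t : ℕ) :
    Measurable fun ω : U × (ℕ → ℝ) => (ω.1, π.history μ ω.1 ω.2 t) :=
  measurable_fst.prodMk (π.measurable_history μ t)

theorem measurableSet_playEvent (π : Policy K U) (μ : Fin K → ℝ) (t : ℕ) (i : Fin K) :
    MeasurableSet (π.playEvent μ t i) := by
  obtain ⟨T, hT, h⟩ := π.exists_playEvent_eq_preimage μ t i
  rw [h]
  exact π.measurable_seed_history μ t hT

/-- The expected number of plays of arm `i` before stopping. -/
noncomputable def expectedPlays (π : Policy K U) (v : ℝ≥0) (μ : Fin K → ℝ) (i : Fin K) : ℝ≥0∞ :=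
  ∑' t, π.noiseLaw v (π.playEvent μ t i)

theorem sum_expectedPlays (π : Policy K U) (v : ℝ≥0) (μ : Fin K → ℝ) :
    ∑ i, π.expectedPlays v μ i = π.expectedStop v μ := by
  have hS : ∀ t : ℕ, MeasurableSet {p | (t : ℕ∞) < π.τ p} := fun t =>
    (obsFiltration K U).le t _ (π.isStoppingTime.measurableSet_gt t)
  have hτ : ∀ p, (π.τ p : ℝ≥0∞) =
      ∑' t : ℕ, {p | (t : ℕ∞) < π.τ p}.indicator (1 : Path K U → ℝ≥0∞) p :=
    fun p => toENNReal_eq_tsum (π.τ p)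
  unfold expectedStop expectedPlays
  simp_rw [hτ]
  rw [lintegral_tsum fun t => (measurable_one.indicator (hS t)).aemeasurable,
    ← Summable.tsum_finsetSum fun i _ => ENNReal.summable]
  refine tsum_congr fun t => ?_
  rw [lintegral_indicator_one (hS t), law, Measure.map_apply (π.measurable_path μ) (hS t),
    ← measure_biUnion_finset]
  · congr 1
    ext ω
    simp [playEvent]
  · intro i _ j _ hij
    refine Set.disjoint_left.2 fun ω hi hj => hij (hi.2.symm.trans hj.2)
  · exact fun i _ => π.measurableSet_playEvent μ t i

/-- The part of arm `i` in the log-likelihood ratio, between two environments, of all that is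
observed before stopping. -/
noncomputable def armLLR (π : Policy K U) (μ μ' : Fin K → ℝ) (v : ℝ≥0) (i : Fin K)
    (ω : U × (ℕ → ℝ)) : ℝ :=
  ∑' t, (π.playEvent μ t i).indicator 1 ω * gaussLLR (μ i) (μ' i) v (μ i + ω.2 t)

/-- Wald's identity for the log-likelihood ratio. -/
theorem integrable_integral_armLLR (π : Policy K U) (μ μ' : Fin K → ℝ) (v : ℝ≥0) (i : Fin K)
    (h : π.expectedPlays v μ i ≠ ∞) :
    Integrable (π.armLLR μ μ' v i) (π.noiseLaw v) ∧
      ∫ ω, π.armLLR μ μ' v i ω ∂(π.noiseLaw v) =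
        (π.expectedPlays v μ i).toReal * ((μ i - μ' i) ^ 2 / (2 * v)) := by
  set Z : ℝ → ℝ := fun e => gaussLLR (μ i) (μ' i) v (μ i + e)
  have hZm : Measurable Z := (measurable_gaussLLR _ _ _).comp (measurable_const_add _)
  have hgauss : (gaussianReal 0 v).map (fun e => μ i + e) = gaussianReal (μ i) v := by
    simpa using gaussianReal_map_const_add (μ := 0) (v := v) (μ i)
  have hZint : Integrable Z (gaussianReal 0 v) := by
    have := integrable_gaussLLR (μ i) (μ' i) (μ i) v
    rw [← hgauss] at this
    exact this.comp_measurable (measurable_const_add _)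
  have hZ : ∫ e, Z e ∂(gaussianReal 0 v) = (μ i - μ' i) ^ 2 / (2 * v) := by
    rw [← integral_gaussLLR (μ i) (μ' i) v, ← hgauss, integral_map (by fun_prop)
      (measurable_gaussLLR _ _ _).aestronglyMeasurable]
  have hmap : ∀ t : ℕ, (π.noiseLaw v).map (fun ω : U × (ℕ → ℝ) => ω.2 t) = gaussianReal 0 v := by
    intro t
    have h2 : (π.noiseLaw v).map Prod.snd = Measure.infinitePi fun _ : ℕ => gaussianReal 0 v := by
      simp [noiseLaw]
    have h3 := Measure.map_map (μ := π.noiseLaw v) (measurable_pi_apply (X := fun _ : ℕ => ℝ) t)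
      measurable_snd
    rw [h2, Measure.infinitePi_map_eval] at h3
    exact h3.symm
  have hN : ∀ t : ℕ, Measurable fun ω : U × (ℕ → ℝ) => ω.2 t := fun t => by fun_prop
  have hZNint : ∀ t : ℕ, Integrable (fun ω : U × (ℕ → ℝ) => Z (ω.2 t)) (π.noiseLaw v) := by
    intro t
    have h3 := hZint
    rw [← hmap t] at h3
    exact h3.comp_measurable (hN t)
  have hI : ∀ t, Integrable ((π.playEvent μ t i).indicator (1 : U × (ℕ → ℝ) → ℝ))
      (π.noiseLaw v) := fun t =>
    (integrable_const (1 : ℝ)).indicator (π.measurableSet_playEvent μ t i)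
  have hprod : ∀ (g : ℝ → ℝ), Measurable g → ∀ t,
      IndepFun ((π.playEvent μ t i).indicator (1 : U × (ℕ → ℝ) → ℝ)) (fun ω => g (ω.2 t))
        (π.noiseLaw v) := by
    intro g hg t
    obtain ⟨T, hT, hTe⟩ := π.exists_playEvent_eq_preimage μ t i
    have h3 := (π.indepFun_history_noise μ v t).comp
      (φ := T.indicator (1 : U × History K t → ℝ)) (ψ := g) (measurable_one.indicator hT) hg
    rw [hTe]
    exact h3
  have hint : ∀ (g : ℝ → ℝ), Measurable g → ∀ t,
      ∫ ω, (π.playEvent μ t i).indicator (1 : U × (ℕ → ℝ) → ℝ) ω * g (ω.2 t) ∂(π.noiseLaw v) =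
        (π.noiseLaw v (π.playEvent μ t i)).toReal * ∫ e, g e ∂(gaussianReal 0 v) := by
    intro g hg t
    rw [(hprod g hg t).integral_fun_mul_eq_mul_integral (hI t).aestronglyMeasurable
      (hg.comp (hN t)).aestronglyMeasurable, integral_indicator_one
      (π.measurableSet_playEvent μ t i), ← hmap t, integral_map (hN t).aemeasurable
      hg.aestronglyMeasurable]
    rfl
  have hF : ∀ t, Integrable (fun ω => (π.playEvent μ t i).indicator (1 : U × (ℕ → ℝ) → ℝ) ω *
      Z (ω.2 t)) (π.noiseLaw v) := fun t =>
    (hprod Z hZm t).integrable_mul (hI t) (hZNint t)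
  have hp : Summable fun t => (π.noiseLaw v (π.playEvent μ t i)).toReal := ENNReal.summable_toReal h
  have hs : Summable fun t => ∫ ω, ‖(π.playEvent μ t i).indicator (1 : U × (ℕ → ℝ) → ℝ) ω *
      Z (ω.2 t)‖ ∂(π.noiseLaw v) := by
    have hnorm : ∀ t ω, ‖(π.playEvent μ t i).indicator (1 : U × (ℕ → ℝ) → ℝ) ω * Z (ω.2 t)‖ =
        (π.playEvent μ t i).indicator (1 : U × (ℕ → ℝ) → ℝ) ω * ‖Z (ω.2 t)‖ := by
      intro t ω
      rw [norm_mul, Real.norm_of_nonneg (Set.indicator_nonneg (f := (1 : U × (ℕ → ℝ) → ℝ))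
        (fun _ _ => zero_le_one) ω)]
    -- The same product formula for `‖Z‖` turns the series of norms into expected plays times a
    -- constant, which permits exchanging sum and integral.
    simp_rw [hnorm, hint (fun e => ‖Z e‖) hZm.norm]
    exact hp.mul_right _
  refine ⟨integrable_tsum_of_summable_integral_norm hF hs, ?_⟩
  unfold armLLR
  rw [← integral_tsum_of_summable_integral_norm hF hs]
  simp_rw [hint Z hZm, hZ]
  rw [tsum_mul_right, expectedPlays, ENNReal.tsum_toReal_eq fun t => measure_ne_top _ _]

/-- The series stop at round `n`, and in each earlier round exactly one arm contributes. -/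
theorem sum_armLLR_eq_logLR (π : Policy K U) (μ μ' : Fin K → ℝ) (v : ℝ≥0) {n : ℕ}
    {ω : U × (ℕ → ℝ)} (hn : π.τ (π.path μ ω) = n) :
    ∑ i, π.armLLR μ μ' v i ω = logLR μ μ' v n (π.history μ ω.1 ω.2 n) := by
  have h1 : ∀ i, π.armLLR μ μ' v i ω = ∑ t ∈ Finset.range n,
      if π.act t (ω.1, π.history μ ω.1 ω.2 t) = i then
        gaussLLR (μ i) (μ' i) v (μ i + ω.2 t) else 0 := by
    intro i
    unfold armLLR
    rw [tsum_eq_sum (s := Finset.range n)]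
    · refine Finset.sum_congr rfl fun t ht => ?_
      have ht' : t < n := Finset.mem_range.1 ht
      simp [playEvent, Set.indicator, hn, ht']
    · intro t ht
      have ht' : ¬ t < n := fun h => ht (Finset.mem_range.2 h)
      simp [playEvent, Set.indicator, hn, ht']
  have h2 : π.history μ ω.1 ω.2 n = (observed n (π.path μ ω)).2 := by rw [observed_path]
  simp_rw [h1]
  rw [Finset.sum_comm, h2, logLR]
  simp only [observed, path, Finset.sum_ite_eq, Finset.mem_univ, if_true]
  rw [Fin.sum_univ_eq_sum_range (fun t => gaussLLR (μ (π.act t (ω.1, π.history μ ω.1 ω.2 t)))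
    (μ' (π.act t (ω.1, π.history μ ω.1 ω.2 t))) v
    (μ (π.act t (ω.1, π.history μ ω.1 ω.2 t)) + ω.2 t)) n]

/-- Change of measure for an event known at the stopping time. -/
theorem lintegral_exp_neg_armLLR_le (π : Policy K U) (μ μ' : Fin K → ℝ) {v : ℝ≥0} (hv : v ≠ 0)
    (hτ : ∀ᵐ ω ∂(π.noiseLaw v), π.τ (π.path μ ω) < ⊤) {B : Set (Path K U)}
    (hB : MeasurableSet[π.isStoppingTime.measurableSpace] B) :
    ∫⁻ ω, (π.path μ ⁻¹' B).indicator
      (fun ω => ENNReal.ofReal (Real.exp (-∑ i, π.armLLR μ μ' v i ω))) ω ∂(π.noiseLaw v) ≤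
      π.law v μ' B := by
  have hBn : ∀ n : ℕ, MeasurableSet[obsFiltration K U n] (B ∩ {p | π.τ p = n}) := fun n =>
    (π.isStoppingTime.measurableSet_inter_eq_iff B n).1
      (hB.inter (π.isStoppingTime.measurableSet_eq_of_countable' n))
  choose T hT hTp hTω using fun n : ℕ => π.path_mem_iff_history_mem μ (hBn n)
  have hTω' : ∀ (n : ℕ) ω, π.path μ' ω ∈ B ∩ {p | π.τ p = n} ↔
      (ω.1, π.history μ' ω.1 ω.2 n) ∈ T n := fun n ω => by
    rw [hTp, observed_path]
  have hmeas : ∀ n : ℕ, Measurable fun ω : U × (ℕ → ℝ) =>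
      (T n).indicator (1 : U × History K n → ℝ≥0∞) (ω.1, π.history μ ω.1 ω.2 n) *
        ENNReal.ofReal (Real.exp (-logLR μ μ' v n (π.history μ ω.1 ω.2 n))) := fun n =>
    ((measurable_one.indicator (hT n)).comp (π.measurable_seed_history μ n)).mul
      ((measurable_logLR μ μ' v n).comp (π.measurable_history μ n)).neg.exp.ennreal_ofReal
  -- The event is split by the value of `τ`, and the change of measure at the fixed round `n` is
  -- applied on each piece.
  calc _ ≤ ∫⁻ ω, ∑' n : ℕ, (T n).indicator (1 : U × History K n → ℝ≥0∞)
        (ω.1, π.history μ ω.1 ω.2 n) *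
        ENNReal.ofReal (Real.exp (-logLR μ μ' v n (π.history μ ω.1 ω.2 n)))
        ∂(π.noiseLaw v) := by
        refine lintegral_mono_ae ?_
        filter_upwards [hτ] with ω hω
        obtain ⟨n, hn⟩ := ENat.ne_top_iff_exists.1 hω.ne
        by_cases hωB : ω ∈ π.path μ ⁻¹' B
        · refine le_trans ?_ (ENNReal.le_tsum n)
          have : (ω.1, π.history μ ω.1 ω.2 n) ∈ T n := (hTω n ω).1 ⟨hωB, hn.symm⟩
          rw [Set.indicator_of_mem hωB, Set.indicator_of_mem this,
            π.sum_armLLR_eq_logLR μ μ' v hn.symm]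
          simp
        · rw [Set.indicator_of_notMem hωB]
          exact zero_le
    _ = ∑' n : ℕ, π.law v μ' (B ∩ {p | π.τ p = n}) := by
        rw [lintegral_tsum fun n => (hmeas n).aemeasurable]
        refine tsum_congr fun n => ?_
        rw [← π.lintegral_history_change μ μ' hv n (measurable_one.indicator (hT n)), law,
          Measure.map_apply (π.measurable_path μ') ((obsFiltration K U).le n _ (hBn n)),
          ← lintegral_indicator_one
            (π.measurable_path μ' ((obsFiltration K U).le n _ (hBn n)))]
        refine lintegral_congr fun ω => ?_
        by_cases h : (ω.1, π.history μ' ω.1 ω.2 n) ∈ T n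
        · rw [Set.indicator_of_mem h, Set.indicator_of_mem (Set.mem_preimage.2 ((hTω' n ω).2 h))]
          rfl
        · rw [Set.indicator_of_notMem h,
            Set.indicator_of_notMem fun h' => h ((hTω' n ω).1 (Set.mem_preimage.1 h'))]
    _ = π.law v μ' (⋃ n : ℕ, B ∩ {p | π.τ p = n}) := by
        rw [measure_iUnion]
        · intro m n hmn
          refine Set.disjoint_left.2 fun p hm hn => hmn ?_
          have : (m : ℕ∞) = n := hm.2.symm.trans hn.2
          exact_mod_cast this
        · exact fun n => (obsFiltration K U).le n _ (hBn n)
    -- Paths of `B` with `τ = ⊤` are dropped here; an inequality suffices.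
    _ ≤ π.law v μ' B := measure_mono (Set.iUnion_subset fun n => Set.inter_subset_left)

end Policy

/-! ### The transportation inequality -/

/-- The weights `1 / (2 * δ)` and `1 / 2` make the subtracted average at most `1`. What remains is
at least `-log 2 - (1 - δ) * log δ`, and the loss `δ * (-log δ) ≤ 1 / 2` is absorbed by the second
`log 2` of `log 4`, since `1 / 2 ≤ log 2`. No smallness of `δ` is needed. -/
theorem log_inv_four_mul_le {δ p q : ℝ} (hδ0 : 0 < δ) (hδ1 : δ < 1) (hp : 1 - δ ≤ p)
    (hq : q ≤ δ) :
    Real.log (1 / (4 * δ)) ≤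
      1 - (1 / (2 * δ) * q + 1 / 2 * (1 - q)) +
        (Real.log (1 / (2 * δ)) * p + Real.log (1 / 2) * (1 - p)) := by
  have hlog : Real.log δ ≤ 0 := Real.log_nonpos hδ0.le hδ1.le
  have h2 : 0.6931471803 < Real.log 2 := Real.log_two_gt_d9
  have h4 : Real.log (1 / (4 * δ)) = -2 * Real.log 2 - Real.log δ := by
    rw [one_div, Real.log_inv, Real.log_mul (by norm_num) hδ0.ne',
      show (4 : ℝ) = 2 ^ 2 by norm_num, Real.log_pow]
    push_cast
    ring
  have h3 : Real.log (1 / (2 * δ)) = -Real.log 2 - Real.log δ := by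
    rw [one_div, Real.log_inv, Real.log_mul (by norm_num) hδ0.ne']
    ring
  have h1 : Real.log (1 / 2) = -Real.log 2 := by rw [one_div, Real.log_inv]
  have h5 : δ * -Real.log δ ≤ 1 / 2 := by
    have h := Real.log_le_sub_one_of_pos (show 0 < 1 / (2 * δ) by positivity)
    rw [h3] at h
    have h' : -Real.log δ ≤ 1 / (2 * δ) := by linarith [Real.log_two_lt_d9]
    calc δ * -Real.log δ ≤ δ * (1 / (2 * δ)) := mul_le_mul_of_nonneg_left h' hδ0.le
      _ = 1 / 2 := by field_simp
  have h6 : 1 / (2 * δ) * q + 1 / 2 * (1 - q) ≤ 1 := by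
    have hc : 1 / 2 ≤ 1 / (2 * δ) := by
      apply one_div_le_one_div_of_le <;> linarith
    have : (1 / (2 * δ) - 1 / 2) * q ≤ (1 / (2 * δ) - 1 / 2) * δ :=
      mul_le_mul_of_nonneg_left hq (by linarith)
    have hd : 1 / (2 * δ) * δ = 1 / 2 := by field_simp
    nlinarith
  have h7 : (1 - δ) * -Real.log δ ≤ p * -Real.log δ :=
    mul_le_mul_of_nonneg_right hp (by linarith)
  rw [h4, h3, h1]
  nlinarith

namespace Policy

variable {K : ℕ} {U : Type*} [MeasurableSpace U]

/-- The transportation inequality: an exact policy must collect, in each environment, enough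
information against each alternative. -/
theorem log_le_sum_expectedPlays (π : Policy K U) {v : ℝ≥0} (hv : v ≠ 0) {δ : ℝ} (hδ0 : 0 < δ)
    (hδ1 : δ < 1) (hπ : π.IsExactOne v δ) {μ μ' : Fin K → ℝ} (hμ : μ ∈ Environments K 1)
    (hμ' : μ' ∈ Alternatives μ) (hfin : ∀ i, π.expectedPlays v μ i ≠ ∞) :
    Real.log (1 / (4 * δ)) ≤
      ∑ i, (π.expectedPlays v μ i).toReal * ((μ i - μ' i) ^ 2 / (2 * v)) := by
  have hprobL : ∀ ν, IsProbabilityMeasure (π.law v ν) := π.isProbabilityMeasure_law v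
  set P := π.noiseLaw v with hP
  set E : Set (Path K U) := {p | changePoints μ = {π.estimate p}} with hE
  have hEm : MeasurableSet[π.isStoppingTime.measurableSpace] E :=
    π.measurable_estimate (MeasurableSet.of_discrete (s := {x | changePoints μ = {x}}))
  have hEm' : MeasurableSet E := π.isStoppingTime.measurableSpace_le _ hEm
  set A : Set (U × (ℕ → ℝ)) := π.path μ ⁻¹' E with hA
  have hAm : MeasurableSet A := π.measurable_path μ hEm'
  have hp : 1 - δ ≤ P.real A := by
    have h := (hπ μ hμ).1
    rw [law, map_measureReal_apply (π.measurable_path μ) hEm'] at h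
    exact h.le
  have hτS : MeasurableSet {p | π.τ p < ⊤} := by
    have h : {p | π.τ p < ⊤} = ⋃ n : ℕ, {p | π.τ p ≤ n} := by
      ext p
      simp only [Set.mem_ofPred_eq, Set.mem_iUnion]
      constructor
      · intro h
        obtain ⟨n, hn⟩ := ENat.ne_top_iff_exists.1 h.ne
        exact ⟨n, hn.ge⟩
      · rintro ⟨n, hn⟩
        exact lt_of_le_of_lt hn (ENat.natCast_lt_top n)
    rw [h]
    exact MeasurableSet.iUnion fun n => (obsFiltration K U).le n _ (π.isStoppingTime n)
  have hτ : ∀ᵐ ω ∂P, π.τ (π.path μ ω) < ⊤ := by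
    have h := (hπ μ hμ).2
    rw [← mem_ae_iff_prob_eq_one hτS, law] at h
    exact ae_of_ae_map (π.measurable_path μ).aemeasurable h
  set q := (π.law v μ').real E with hqdef
  have hq : q ≤ δ := by
    have h := (hπ μ' hμ'.1).1
    have hE' : MeasurableSet {p | changePoints μ' = {π.estimate p}} :=
      π.isStoppingTime.measurableSpace_le _
        (π.measurable_estimate (MeasurableSet.of_discrete (s := {x | changePoints μ' = {x}})))
    -- The two environments have different change points, so one estimate cannot be correct for
    -- both.
    have hd : Disjoint E {p | changePoints μ' = {π.estimate p}} :=
      Set.disjoint_left.2 fun p h1 h2 => hμ'.2 (h2.trans h1.symm)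
    have h1 := measureReal_union (μ := π.law v μ') hd hE'
    have h2 := measureReal_le_one (μ := π.law v μ')
      (s := E ∪ {p | changePoints μ' = {π.estimate p}})
    linarith
  set L : U × (ℕ → ℝ) → ℝ := fun ω => ∑ i, π.armLLR μ μ' v i ω with hL
  have hLint : Integrable L P :=
    integrable_finsetSum _ fun i _ => (π.integrable_integral_armLLR μ μ' v i (hfin i)).1
  have hLval : ∫ ω, L ω ∂P =
      ∑ i, (π.expectedPlays v μ i).toReal * ((μ i - μ' i) ^ 2 / (2 * v)) := by
    rw [hL, integral_finsetSum _ fun i _ =>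
      (π.integrable_integral_armLLR μ μ' v i (hfin i)).1]
    exact Finset.sum_congr rfl fun i _ => (π.integrable_integral_armLLR μ μ' v i (hfin i)).2
  have hRm : AEStronglyMeasurable (fun ω => Real.exp (-L ω)) P :=
    (Real.continuous_exp.comp continuous_neg).comp_aestronglyMeasurable hLint.aestronglyMeasurable
  have hchange : ∀ B : Set (Path K U), MeasurableSet[π.isStoppingTime.measurableSpace] B →
      Integrable ((π.path μ ⁻¹' B).indicator fun ω => Real.exp (-L ω)) P ∧
        ∫ ω, (π.path μ ⁻¹' B).indicator (fun ω => Real.exp (-L ω)) ω ∂P ≤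
          (π.law v μ').real B := by
    intro B hB
    have hle := π.lintegral_exp_neg_armLLR_le μ μ' hv hτ hB
    have hBm := π.measurable_path μ (π.isStoppingTime.measurableSpace_le _ hB)
    have hpos : ∀ ω, 0 ≤ (π.path μ ⁻¹' B).indicator (fun ω => Real.exp (-L ω)) ω := fun ω =>
      Set.indicator_nonneg (fun _ _ => (Real.exp_pos _).le) ω
    have hof : ∀ ω, ENNReal.ofReal ((π.path μ ⁻¹' B).indicator (fun ω => Real.exp (-L ω)) ω) =
        (π.path μ ⁻¹' B).indicator (fun ω => ENNReal.ofReal (Real.exp (-L ω))) ω := fun ω => by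
      by_cases h : ω ∈ π.path μ ⁻¹' B <;> simp [h]
    have hm := hRm.indicator hBm
    constructor
    · refine ⟨hm, ?_⟩
      rw [hasFiniteIntegral_iff_ofReal (Filter.Eventually.of_forall hpos)]
      simp_rw [hof]
      exact lt_of_le_of_lt hle (measure_lt_top _ _)
    · rw [integral_eq_lintegral_of_nonneg_ae (Filter.Eventually.of_forall hpos) hm]
      simp_rw [hof]
      exact ENNReal.toReal_mono (measure_ne_top _ _) hle
  obtain ⟨hR1, hR1le⟩ := hchange E hEm
  obtain ⟨hR2, hR2le⟩ := hchange Eᶜ hEm.compl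
  rw [probReal_compl_eq_one_sub hEm'] at hR2le
  set c : ℝ := 1 / (2 * δ) with hc
  have hcpos : 0 < c := by positivity
  have hone : Integrable (A.indicator (1 : U × (ℕ → ℝ) → ℝ)) P :=
    (integrable_const (1 : ℝ)).indicator hAm
  have hone' : Integrable (Aᶜ.indicator (1 : U × (ℕ → ℝ) → ℝ)) P :=
    (integrable_const (1 : ℝ)).indicator hAm.compl
  -- The constant is `c` on `E` and `1 / 2` off `E`. The exponential terms carry negative
  -- coefficients, so upper bounds on their integrals suffice.
  have hpoint : ∀ ω, 1 - (c * (π.path μ ⁻¹' E).indicator (fun ω => Real.exp (-L ω)) ω +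
      1 / 2 * (π.path μ ⁻¹' Eᶜ).indicator (fun ω => Real.exp (-L ω)) ω) +
      (Real.log c * A.indicator 1 ω + Real.log (1 / 2) * Aᶜ.indicator 1 ω) ≤ L ω := by
    intro ω
    -- This is `log x ≤ x - 1` at `x = s * exp (-L ω)`.
    have key : ∀ s : ℝ, 0 < s → 1 - s * Real.exp (-L ω) + Real.log s ≤ L ω := by
      intro s hs
      have h := Real.log_le_sub_one_of_pos (mul_pos hs (Real.exp_pos (-L ω)))
      rw [Real.log_mul hs.ne' (Real.exp_pos _).ne', Real.log_exp] at h
      linarith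
    by_cases h : π.path μ ω ∈ E
    · have h' := key c hcpos
      simpa [hA, Set.indicator, h] using h'
    · have h' := key (1 / 2) (by norm_num)
      simpa [hA, Set.indicator, h] using h'
  have hint := integral_mono (μ := P)
    (((integrable_const (1 : ℝ)).sub ((hR1.const_mul c).add (hR2.const_mul (1 / 2)))).add
      ((hone.const_mul (Real.log c)).add (hone'.const_mul (Real.log (1 / 2))))) hLint hpoint
  have hcalc := integral_add
    ((integrable_const (μ := P) (1 : ℝ)).sub ((hR1.const_mul c).add (hR2.const_mul (1 / 2))))
      ((hone.const_mul (Real.log c)).add (hone'.const_mul (Real.log (1 / 2))))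
  rw [integral_sub' (integrable_const (1 : ℝ)) ((hR1.const_mul c).add (hR2.const_mul (1 / 2))),
    integral_add' (hR1.const_mul c) (hR2.const_mul (1 / 2)),
    integral_add' (hone.const_mul (Real.log c)) (hone'.const_mul (Real.log (1 / 2))),
    integral_const_mul, integral_const_mul, integral_const_mul, integral_const_mul,
    integral_indicator_one hAm, integral_indicator_one hAm.compl, probReal_compl_eq_one_sub hAm,
    integral_const, probReal_univ, one_smul] at hcalc
  have hfinal := log_inv_four_mul_le hδ0 hδ1 hp hq
  have hmul := mul_le_mul_of_nonneg_left hR1le hcpos.le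
  have hint' := hcalc.symm.le.trans hint
  rw [hLval] at hint'
  rw [← hc] at hfinal
  linarith

end Policy

/-! ### Optimization over allocations and conclusion -/

/-- The inverse of `c*` is at least the information collected per round. -/
theorem ofReal_log_div_expectedStop_le_inv_cStar {K : ℕ} {U : Type*} [MeasurableSpace U]
    {σ2 : ℝ≥0} (hσ2 : σ2 ≠ 0)
    {δ : ℝ} (hδ0 : 0 < δ) (hδ1 : δ < 1) (π : Policy K U) (hπ : π.IsExactOne σ2 δ)
    {μ : Fin K → ℝ} (hμ : μ ∈ Environments K 1) (hlog : 0 < Real.log (1 / (4 * δ)))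
    (hfin : π.expectedStop σ2 μ ≠ ∞) :
    ENNReal.ofReal (Real.log (1 / (4 * δ))) / π.expectedStop σ2 μ ≤ (cStar σ2 μ)⁻¹ := by
  rw [cStar, inv_inv]
  have hsum := π.sum_expectedPlays σ2 μ
  have hfin' : ∀ i, π.expectedPlays σ2 μ i ≠ ∞ := fun i =>
    ne_top_of_le_ne_top hfin (hsum ▸ Finset.single_le_sum
      (f := fun i => π.expectedPlays σ2 μ i) (fun _ _ => zero_le) (Finset.mem_univ i))
  have hkey := fun μ' (hμ' : μ' ∈ Alternatives μ) =>
    π.log_le_sum_expectedPlays hσ2 hδ0 hδ1 hπ hμ hμ' hfin'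
  -- Without any play no information is collected, while each alternative demands a positive amount;
  -- hence there is none, and the infimum is `∞` at any point of the simplex.
  by_cases h0 : π.expectedStop σ2 μ = 0
  · have hK : Nonempty (Fin K) := by
      obtain ⟨x, -⟩ := Finset.card_pos.1 (hμ.1 ▸ Nat.one_pos)
      exact ⟨⟨x, by omega⟩⟩
    have hz : ∀ i, π.expectedPlays σ2 μ i = 0 := by
      rw [h0, Finset.sum_eq_zero_iff] at hsum
      exact fun i => hsum i (Finset.mem_univ i)
    have hempty : ∀ μ', μ' ∉ Alternatives μ := fun μ' hμ' => by
      have h := hkey μ' hμ'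
      simp only [hz, ENNReal.toReal_zero, zero_mul, Finset.sum_const_zero] at h
      linarith
    obtain ⟨i⟩ := hK
    refine le_trans ?_ (le_iSup₂ (Pi.single i 1) (single_mem_stdSimplex ℝ i))
    simp [hempty]
  · set N := (π.expectedStop σ2 μ).toReal with hN
    have hNpos : 0 < N := ENNReal.toReal_pos h0 hfin
    have hsumR : ∑ i, (π.expectedPlays σ2 μ i).toReal = N := by
      rw [← ENNReal.toReal_sum fun i _ => hfin' i, hsum]
    -- The allocation of the policy itself: the expected fraction of rounds spent on each arm.
    have hα : (fun i => (π.expectedPlays σ2 μ i).toReal / N) ∈ stdSimplex ℝ (Fin K) :=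
      ⟨fun i => div_nonneg ENNReal.toReal_nonneg hNpos.le, by
        rw [← Finset.sum_div, hsumR, div_self hNpos.ne']⟩
    refine le_trans ?_ (le_iSup₂ _ hα)
    refine le_iInf₂ fun μ' hμ' => ?_
    calc ENNReal.ofReal (Real.log (1 / (4 * δ))) / π.expectedStop σ2 μ
        = ENNReal.ofReal (Real.log (1 / (4 * δ)) / N) := by
          rw [ENNReal.ofReal_div_of_pos hNpos, hN, ENNReal.ofReal_toReal hfin]
      _ ≤ ENNReal.ofReal (∑ i, (π.expectedPlays σ2 μ i).toReal / N *
            ((μ i - μ' i) ^ 2 / (2 * σ2))) := by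
          refine ENNReal.ofReal_le_ofReal ?_
          rw [div_le_iff₀ hNpos, Finset.sum_mul]
          refine (hkey μ' hμ').trans (Finset.sum_le_sum fun i _ => le_of_eq ?_)
          rw [mul_right_comm, div_mul_cancel₀ _ hNpos.ne']
      _ = ∑ i, ENNReal.ofReal ((π.expectedPlays σ2 μ i).toReal / N) *
            ENNReal.ofReal ((μ i - μ' i) ^ 2 / (2 * σ2)) := by
          rw [ENNReal.ofReal_sum_of_nonneg fun i _ => mul_nonneg (hα.1 i) (by positivity)]
          exact Finset.sum_congr rfl fun i _ => ENNReal.ofReal_mul (hα.1 i)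
      _ ≤ _ := Finset.sum_le_sum fun i _ => mul_le_mul_right (le_klDiv_gaussianReal _ _ hσ2) _

end PiecewiseBandit

theorem mainTheorem9 (K : ℕ) {U : Type*} [MeasurableSpace U]
    (σ2 : ℝ≥0) (hσ2 : σ2 ≠ 0) (δ : ℝ) (hδ0 : 0 < δ) (hδ1 : δ < 1)
    (π : PiecewiseBandit.Policy K U) (hπ : π.IsExactOne σ2 δ)
    (μ : Fin K → ℝ) (hμ : μ ∈ PiecewiseBandit.Environments K 1) :
    ((PiecewiseBandit.cStar σ2 μ : ℝ≥0∞) : EReal) * ((Real.log (1 / (4 * δ)) : ℝ) : EReal)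
      ≤ ((π.expectedStop σ2 μ : ℝ≥0∞) : EReal) := by
  -- For `δ ≥ 1 / 4` the logarithm is not positive and the bound is trivial, even with `cStar`
  -- infinite.
  rcases le_or_gt (Real.log (1 / (4 * δ))) 0 with hlog | hlog
  · exact (EReal.mul_nonpos_iff.2
      (Or.inl ⟨EReal.coe_ennreal_nonneg _, by exact_mod_cast hlog⟩)).trans (EReal.coe_ennreal_nonneg _)
  by_cases hfin : π.expectedStop σ2 μ = ∞
  · rw [hfin]
    exact le_top
  have h := PiecewiseBandit.ofReal_log_div_expectedStop_le_inv_cStar hσ2 hδ0 hδ1 π hπ hμ hlog hfin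
  have hpos : ENNReal.ofReal (Real.log (1 / (4 * δ))) ≠ 0 := (ENNReal.ofReal_pos.2 hlog).ne'
  have hE : ((Real.log (1 / (4 * δ)) : ℝ) : EReal) =
      ((ENNReal.ofReal (Real.log (1 / (4 * δ))) : ℝ≥0∞) : EReal) := by
    rw [EReal.coe_ennreal_ofReal, max_eq_left hlog.le]
  rw [hE, ← EReal.coe_ennreal_mul, EReal.coe_ennreal_le_coe_ennreal_iff]
  -- Inversion isolates `cStar`; the logarithm, now positive and finite, can then be multiplied
  -- back.
  have h' := ENNReal.inv_le_inv.2 h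
  rw [inv_inv, ENNReal.inv_div (Or.inl hfin) (Or.inr hpos)] at h'
  calc _ ≤ π.expectedStop σ2 μ / ENNReal.ofReal (Real.log (1 / (4 * δ))) *
        ENNReal.ofReal (Real.log (1 / (4 * δ))) := mul_le_mul_left h' _
    _ = _ := ENNReal.div_mul_cancel hpos ENNReal.ofReal_ne_top
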